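/- Let $R$ be an integral domain with field of fractions $\mathbb F$, and let $A_0\subseteq A_1\subseteq A_2\subseteq\cdots$ be an increasing sequence (with unital inclusions and consistent involutions $*$) of cellular $R$-algebras. Write $(\widehat A_r,\unrhd)$ for the finite poset, $\{c^\lambda_{st}\}$ for the cellular basis and $\Delta_r(\lambda)$ for the (right) cell modules of $A_r$, and let $A_r^{\rhd\lambda}$, $A_r^{\unrhd\lambda}$ be the spans of the $c^\mu_{st}$ with $\mu\rhd\lambda$, respectively $\mu\unrhd\lambda$. Assume that $(A_r)_{r\ge0}$ is a *sequence of diagram algebras*, that is: 1. $A_0=R$ (and $\widehat A_0=\{\varnothing\}$). 2. Every cell module $\Delta_r(\lambda)$ is cyclic; fix a generator $\delta_r(\lambda)$, a bimodule isomorphism $\alpha_\lambda:A_r^{\unrhd\lambda}/A_r^{\rhd\lambda}\to\Delta_r(\lambda)^*\otimes_R\Delta_r(\lambda)$, and $m_\lambda\in A_r^{\unrhd\lambda}$ with $\alpha_\lambda(m_\lambda+A_r^{\rhd\lambda})=\delta_r(\lambda)^*\otimes\delta_r(\lambda)$, where $m_\varnothing=1$. 3. $m_\lambda^*=m_\lambda$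 for all $\lambda$. 4. $A_r\otimes_R\mathbb F$ is split semisimple for every $r$. 5. For every $\mu\in\widehat A_{r+1}$ the restriction of $\Delta_{r+1}(\mu)$ to $A_r$ has an order preserving cell filtration $0=M_0\subseteq M_1\subseteq\cdots\subseteq M_n=\Delta_{r+1}(\mu)$, that is, $M_i/M_{i-1}\cong\Delta_r(\lambda^{(i)})$ as $A_r$-modules with $\lambda^{(1)}\rhd\cdots\rhd\lambda^{(n)}$. Fix such a filtration and such isomorphisms, and fix branching factors $d_{\lambda^{(i)}\to\mu}\in A_{r+1}$ such that $\delta_{r+1}(\mu)\,d_{\lambda^{(i)}\to\mu}\in M_i$ and its class in $M_i/M_{i-1}$ corresponds to $\delta_r(\lambda^{(i)})$. For $\lambda\in\widehat A_r$ and $\mu\in\widehat A_{r+1}$, write $\lambda\to\mu$ if $\Delta_r(\lambda)$ occurs as a subquotient in an order preserving cell filtration of the restriction of $\Delta_{r+1}(\mu)$ to $A_r$; these are the edges of the branching diagram. 6. For every edge $\lambda\to\mu$ with $\lambda\in\widehat A_r$, $\mu\in\widehat A_{r+1}$, there is an element $u_{\lambda\to\mu}\in A_{r+1}$ with $m_\mu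 d_{\lambda\to\mu}=(u_{\lambda\to\mu})^*m_\lambda$; fix such elements. For $\nu\in\widehat A_r$ let $\mathrm{Std}_r(\nu)$ be the set of directed paths $t=(\varnothing=t(0)\to t(1)\to\cdots\to t(r)=\nu)$ in the branching diagram, and put $u_t=u_{t(0)\to t(1)}u_{t(1)\to t(2)}\cdots u_{t(r-1)\to t(r)}$. For $s\le r$ let $t_{[0,s]}$ be the truncated path $t(0)\to\cdots\to t(s)$, and for paths $v,w$ of length $s$ let $w\unrhd v$ mean $w(j)\unrhd v(j)$ for all $0\le j\le s$ (dominance order). **Proposition.** Let $0\le s<r$, $\nu\in\widehat A_r$ and $t\in\mathrm{Std}_r(\nu)$. Let $x\in A_r\cap A_s'$, i.e. $x\in A_r$ commutes with every element of $A_s$. Then there exist coefficients $r_w\in R$ such that $$u_t^*\,x\;\equiv\;\sum_{\substack{w\in\mathrm{Std}_r(\nu)\\ w_{[0,s]}\,\unrhd\, t_{[0,s]}}} r_w\,u_w^*\qquad\mod A_r^{\rhd\nu}.$$ -/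

import Mathlib

open scoped TensorProduct

/-- An `R`-linear anti-automorphism `*` of the `R`-algebra `A` with `x** = x`. -/
structure AlgInvolution (R A : Type*) [CommRing R] [Ring A] [Algebra R A] where
  toFun : A →ₗ[R] A
  map_mul : ∀ x y, toFun (x * y) = toFun y * toFun x
  invol : ∀ x, toFun (toFun x) = x

/-- The restriction of an involution to an involution-invariant subalgebra. -/
def AlgInvolution.restrict {R B : Type*} [CommRing R] [Ring B] [Algebra R B]
    (inv : AlgInvolution R B) (A : Subalgebra R B) (h : ∀ x ∈ A, inv.toFun x ∈ A) :
    AlgInvolution R A where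
  toFun := (inv.toFun.comp A.val.toLinearMap).codRestrict (Subalgebra.toSubmodule A)
    (fun x => h x x.2)
  map_mul x y := Subtype.ext (inv.map_mul x y)
  invol x := Subtype.ext (inv.invol x)

/-- A cell datum for the algebra `A` with involution `inv`: the finite poset of labels is `Λ`
(`μ ⊵ λ` is written `λ ≤ μ`), the finite index sets are `S λ`, and `c ⟨λ, (s, t)⟩` is the basis
element `c^λ_{st}`.  The two congruences are modulo `A^{▷λ}`, the span of the `c^μ_{pq}`
with `μ ▷ λ`. -/
structure CellDatum (R A : Type*) [CommRing R] [Ring A] [Algebra R A] (inv : AlgInvolution R A)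
    (Λ : Type*) [PartialOrder Λ] (S : Λ → Type*) [∀ l, Fintype (S l)] where
  c : Module.Basis (Σ l, S l × S l) R A
  mul_right : ∀ (l : Λ) (t : S l) (a : A), ∃ ρ : S l → R, ∀ s : S l,
    c ⟨l, (s, t)⟩ * a - ∑ v, ρ v • c ⟨l, (s, v)⟩ ∈
      Submodule.span R {y | ∃ (μ : Λ) (p q : S μ), l < μ ∧ y = c ⟨μ, (p, q)⟩}
  star_basis : ∀ (l : Λ) (s t : S l),
    inv.toFun (c ⟨l, (s, t)⟩) - c ⟨l, (t, s)⟩ ∈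
      Submodule.span R {y | ∃ (μ : Λ) (p q : S μ), l < μ ∧ y = c ⟨μ, (p, q)⟩}

namespace CellDatum

variable {R A : Type*} [CommRing R] [Ring A] [Algebra R A] {inv : AlgInvolution R A}
  {Λ : Type*} [PartialOrder Λ] {S : Λ → Type*} [∀ l, Fintype (S l)]

/-- `A^{▷λ}`. -/
def above (D : CellDatum R A inv Λ S) (l : Λ) : Submodule R A :=
  Submodule.span R {y | ∃ (μ : Λ) (p q : S μ), l < μ ∧ y = D.c ⟨μ, (p, q)⟩}

/-- `A^{⊵λ}`. -/
def aboveEq (D : CellDatum R A inv Λ S) (l : Λ) : Submodule R A :=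
  Submodule.span R {y | ∃ (μ : Λ) (p q : S μ), l ≤ μ ∧ y = D.c ⟨μ, (p, q)⟩}

/-- The coefficient `r(a; t, v)` in `c_{st} a ≡ ∑ v, r(a; t, v) c_{sv}` modulo `A^{▷λ}`, which
does not depend on `s` and is read off here at `s = t`; see `coeff_spec`. -/
noncomputable def coeff (D : CellDatum R A inv Λ S) (l : Λ) (a : A) (t v : S l) : R :=
  D.c.repr (D.c ⟨l, (t, t)⟩ * a) ⟨l, (t, v)⟩

/-- The right action of `A` on the cell module `Δ(λ)`.  The cell module is the free module
`S λ → R`, whose standard basis vectors are the `c^λ_t`, and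
`c^λ_t a = ∑ v, r(a; t, v) c^λ_v`.  We write `D.act l a x` for `x a`. -/
noncomputable def act (D : CellDatum R A inv Λ S) (l : Λ) :
    A →ₗ[R] (S l → R) →ₗ[R] (S l → R) :=
  LinearMap.mk₂ R (fun a x v => ∑ t, x t * D.coeff l a t v)
    (fun a b x => by
      funext v
      simp [coeff, mul_add, Finset.sum_add_distrib])
    (fun k a x => by
      funext v
      simp [coeff, Finset.mul_sum, mul_left_comm])
    (fun a x y => by
      funext v
      simp [add_mul, Finset.sum_add_distrib])
    (fun k a x => by
      funext v
      simp [Finset.mul_sum, mul_assoc])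

theorem repr_above (D : CellDatum R A inv Λ S) (l : Λ) {y : A} (hy : y ∈ D.above l)
    (p q : S l) : D.c.repr y ⟨l, (p, q)⟩ = 0 := by
  classical
  unfold above at hy
  induction hy using Submodule.span_induction with
  | mem y h =>
    obtain ⟨μ, p', q', hlt, rfl⟩ := h
    rw [D.c.repr_self, Finsupp.single_apply, if_neg]
    intro h
    exact hlt.ne' (congrArg Sigma.fst h)
  | zero => simp
  | add x y _ _ hx hy => simp [hx, hy]
  | smul k x _ hx => simp [hx]

theorem coeff_spec (D : CellDatum R A inv Λ S) (l : Λ) (a : A) (s t : S l) :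
    D.c ⟨l, (s, t)⟩ * a - ∑ v, D.coeff l a t v • D.c ⟨l, (s, v)⟩ ∈ D.above l := by
  classical
  obtain ⟨ρ, hρ⟩ := D.mul_right l t a
  have key : ∀ v, D.coeff l a t v = ρ v := by
    intro v
    have h := D.repr_above l (hρ t) t v
    rw [map_sub, Finsupp.sub_apply, sub_eq_zero] at h
    rw [coeff, h, map_sum, Finsupp.finsetSum_apply, Finset.sum_eq_single v]
    · simp
    · intro w _ hw
      simp [hw]
    · simp
  simp only [key]
  exact hρ s

theorem above_mul (D : CellDatum R A inv Λ S) (l : Λ) {y : A} (hy : y ∈ D.above l) (a : A) :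
    y * a ∈ D.above l := by
  unfold above at hy
  induction hy using Submodule.span_induction with
  | mem y h =>
    obtain ⟨μ, p, q, hlt, rfl⟩ := h
    have h1 : D.above μ ≤ D.above l := by
      refine Submodule.span_mono ?_
      rintro _ ⟨κ, p, q, h, rfl⟩
      exact ⟨κ, p, q, hlt.trans h, rfl⟩
    have h2 := h1 (D.coeff_spec μ a p q)
    have h3 : ∑ v, D.coeff μ a q v • D.c ⟨μ, (p, v)⟩ ∈ D.above l :=
      Submodule.sum_mem _ fun v _ => Submodule.smul_mem _ _
        (Submodule.subset_span ⟨μ, p, v, hlt, rfl⟩)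
    simpa using Submodule.add_mem _ h2 h3
  | zero => simp
  | add x y _ _ hx hy =>
    rw [add_mul]
    exact Submodule.add_mem _ hx hy
  | smul k x _ hx =>
    rw [smul_mul_assoc]
    exact Submodule.smul_mem _ _ hx

/-- The cell module is a right module: `x 1 = x`. -/
theorem act_one (D : CellDatum R A inv Λ S) (l : Λ) (x : S l → R) : D.act l 1 x = x := by
  classical
  funext v
  simp only [act, LinearMap.mk₂_apply, coeff, mul_one, D.c.repr_self]
  rw [Finset.sum_eq_single v]
  · simp
  · intro w _ hw
    simp [hw]
  · simp

/-- The cell module is a right module: `x (a b) = (x a) b`. -/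
theorem act_mul (D : CellDatum R A inv Λ S) (l : Λ) (a b : A) (x : S l → R) :
    D.act l (a * b) x = D.act l b (D.act l a x) := by
  classical
  have key : ∀ t v, D.coeff l (a * b) t v = ∑ w, D.coeff l a t w * D.coeff l b w v := by
    intro t v
    have h1 := D.above_mul l (D.coeff_spec l a t t) b
    have h2 : ∑ w, D.coeff l a t w • (D.c ⟨l, (t, w)⟩ * b -
        ∑ v, D.coeff l b w v • D.c ⟨l, (t, v)⟩) ∈ D.above l :=
      Submodule.sum_mem _ fun w _ => Submodule.smul_mem _ _ (D.coeff_spec l b t w)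
    have h3 := D.repr_above l (Submodule.add_mem _ h1 h2) t v
    have h4 : (D.c ⟨l, (t, t)⟩ * a - ∑ v, D.coeff l a t v • D.c ⟨l, (t, v)⟩) * b +
        ∑ w, D.coeff l a t w • (D.c ⟨l, (t, w)⟩ * b -
        ∑ v, D.coeff l b w v • D.c ⟨l, (t, v)⟩) = D.c ⟨l, (t, t)⟩ * (a * b) -
        ∑ w, D.coeff l a t w • ∑ v, D.coeff l b w v • D.c ⟨l, (t, v)⟩ := by
      simp only [smul_sub, Finset.sum_sub_distrib, sub_mul, Finset.sum_mul, smul_mul_assoc,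
        mul_assoc]
      abel
    rw [h4, map_sub, Finsupp.sub_apply, sub_eq_zero] at h3
    rw [coeff, h3, map_sum, Finsupp.finsetSum_apply]
    refine Finset.sum_congr rfl fun w _ => ?_
    rw [map_smul, Finsupp.smul_apply, smul_eq_mul, map_sum, Finsupp.finsetSum_apply,
      Finset.sum_eq_single v]
    · simp
    · intro w' _ hw
      simp [hw]
    · simp
  funext v
  simp only [act, LinearMap.mk₂_apply, key, Finset.mul_sum, Finset.sum_mul]
  rw [Finset.sum_comm]
  simp only [mul_assoc]

/-- An isomorphism of `A`-`A`-bimodules `A^{⊵λ} / A^{▷λ} ≅ Δ(λ)* ⊗ Δ(λ)`, given as a surjection on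
`A^{⊵λ}` with kernel `A^{▷λ}`.  The left action on `Δ(λ)*` is `a y* = (y a*)*`. -/
structure BimoduleIso (D : CellDatum R A inv Λ S) (l : Λ) where
  toFun : D.aboveEq l →ₗ[R] (S l → R) ⊗[R] (S l → R)
  surjective : Function.Surjective toFun
  ker : ∀ x, toFun x = 0 ↔ (x : A) ∈ D.above l
  map_mul_right : ∀ (x y : D.aboveEq l) (a : A), (y : A) = x * a →
    toFun y = TensorProduct.map LinearMap.id (D.act l a) (toFun x)
  map_mul_left : ∀ (x y : D.aboveEq l) (a : A), (y : A) = a * x →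
    toFun y = TensorProduct.map (D.act l (inv.toFun a)) LinearMap.id (toFun x)

/-- An order preserving cell filtration `0 = M_0 ⊆ M_1 ⊆ ⋯ ⊆ M_n = M` of a right `A`-module `M`
with action `ρ` (`ρ a x` is `x a`): the subquotient `M_{i+1} / M_i` is isomorphic to
the cell module of `label i`, and the labels strictly decrease.  The isomorphism is given as a
surjective `A`-linear map on `M_{i+1}` with kernel `M_i`. -/
structure CellFiltration (D : CellDatum R A inv Λ S) {M : Type*} [AddCommGroup M] [Module R M]
    (ρ : A →ₗ[R] M →ₗ[R] M) where
  n : ℕ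
  sub : Fin (n + 1) → Submodule R M
  sub_zero : sub 0 = ⊥
  sub_last : sub (Fin.last n) = ⊤
  mono : ∀ i : Fin n, sub i.castSucc ≤ sub i.succ
  stable : ∀ i, ∀ x ∈ sub i, ∀ a, ρ a x ∈ sub i
  label : Fin n → Λ
  label_anti : StrictAnti label
  proj : ∀ i : Fin n, sub i.succ →ₗ[R] (S (label i) → R)
  proj_surjective : ∀ i, Function.Surjective (proj i)
  proj_ker : ∀ i x, proj i x = 0 ↔ (x : M) ∈ sub i.castSucc
  proj_act : ∀ i (x : sub i.succ) (a : A),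
    proj i ⟨ρ a x, stable i.succ x x.2 a⟩ = D.act (label i) a (proj i x)

end CellDatum

/-- An algebra over a field is split semisimple if it is a finite product of full matrix
algebras over that field. -/
def IsSplitSemisimple (K A : Type*) [Field K] [Ring A] [Algebra K A] : Prop :=
  ∃ (n : ℕ) (d : Fin n → ℕ), (∀ i, 0 < d i) ∧
    Nonempty (A ≃ₐ[K] (∀ i, Matrix (Fin (d i)) (Fin (d i)) K))

/-- An increasing sequence `A 0 ⊆ A 1 ⊆ ⋯` of cellular algebras over `R` with consistent
involutions.  The algebras are unital subalgebras of an algebra `B` with involution (for instance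
of their union); the involution of `A r` is the restriction of that of `B`. -/
structure CellularTower (R B : Type*) [CommRing R] [Ring B] [Algebra R B]
    (Λ : ℕ → Type*) [∀ r, PartialOrder (Λ r)]
    (S : ∀ r, Λ r → Type*) [∀ r l, Fintype (S r l)] where
  A : ℕ → Subalgebra R B
  mono : Monotone A
  inv : AlgInvolution R B
  inv_mem : ∀ r, ∀ x ∈ A r, inv.toFun x ∈ A r
  cell : ∀ r, CellDatum R (A r) (inv.restrict (A r) (inv_mem r)) (Λ r) (S r)

namespace CellularTower

variable {R B : Type*} [CommRing R] [Ring B] [Algebra R B]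
    {Λ : ℕ → Type*} [∀ r, PartialOrder (Λ r)]
    {S : ∀ r, Λ r → Type*} [∀ r l, Fintype (S r l)]

/-- The cell module `Δ_{r+1}(μ)`, restricted to `A r`. -/
noncomputable def resAct (T : CellularTower R B Λ S) (r : ℕ) (μ : Λ (r + 1)) :
    T.A r →ₗ[R] (S (r + 1) μ → R) →ₗ[R] (S (r + 1) μ → R) :=
  ((T.cell (r + 1)).act μ).comp (Subalgebra.inclusion (T.mono (Nat.le_succ r))).toLinearMap

/-- The edge relation `λ → μ` of the branching diagram: `Δ_r(λ)` occurs as a subquotient in an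
order preserving cell filtration of the restriction of `Δ_{r+1}(μ)` to `A r`. -/
def Edge (T : CellularTower R B Λ S) (r : ℕ) (l : Λ r) (μ : Λ (r + 1)) : Prop :=
  ∃ (𝓜 : (T.cell r).CellFiltration (T.resAct r μ)) (i : Fin 𝓜.n), 𝓜.label i = l

/-- `A_r^{▷ν}` as a submodule of `B`. -/
def ideal (T : CellularTower R B Λ S) (r : ℕ) (ν : Λ r) : Submodule R B :=
  ((T.cell r).above ν).map (T.A r).val.toLinearMap

/-- `Std_r`: directed paths `t 0 → t 1 → ⋯ → t r` on the branching diagram. -/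
@[ext]
structure Tableau (T : CellularTower R B Λ S) (r : ℕ) where
  vertex : ∀ j, j ≤ r → Λ j
  edge : ∀ j (h : j + 1 ≤ r),
    T.Edge j (vertex j ((Nat.le_succ j).trans h)) (vertex (j + 1) h)

/-- `Std_r(ν)`: the paths of length `r` that end in `ν`. -/
def Std (T : CellularTower R B Λ S) (r : ℕ) (ν : Λ r) : Type _ :=
  {t : T.Tableau r // t.vertex r le_rfl = ν}

/-- The truncated path `t_{[0,s]}`. -/
def Tableau.trunc {T : CellularTower R B Λ S} {r : ℕ} (t : T.Tableau r) (s : ℕ) (h : s ≤ r) :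
    T.Tableau s where
  vertex j hj := t.vertex j (hj.trans h)
  edge j hj := t.edge j (hj.trans h)

/-- The dominance order on paths: `t ≤ w` means `w ⊵ t`, that is, `w j ⊵ t j` for all `j`. -/
instance {T : CellularTower R B Λ S} {r : ℕ} : PartialOrder (T.Tableau r) where
  le t w := ∀ j h, t.vertex j h ≤ w.vertex j h
  le_refl t j h := le_rfl
  le_trans t w z h1 h2 j h := (h1 j h).trans (h2 j h)
  le_antisymm t w h1 h2 := by
    ext j h
    exact le_antisymm (h1 j h) (h2 j h)

theorem tableau_finite [∀ r, Finite (Λ r)] (T : CellularTower R B Λ S) (r : ℕ) :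
    Finite (T.Tableau r) := by
  refine Finite.of_injective
    (fun t : T.Tableau r => fun j : Fin (r + 1) => t.vertex j (Nat.le_of_lt_succ j.2)) ?_
  intro t w h
  ext j hj
  exact congrFun h ⟨j, Nat.lt_succ_of_le hj⟩

noncomputable instance [∀ r, Finite (Λ r)] (T : CellularTower R B Λ S) (r : ℕ) (ν : Λ r) :
    Fintype (T.Std r ν) :=
  have := T.tableau_finite r
  have : Finite (T.Std r ν) := Subtype.finite
  Fintype.ofFinite _

end CellularTower

/-- A sequence of diagram algebras over the integral domain `R` with field of fractions `𝔽`,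
with all the choices made for it: the generators `δ_r(λ)` of the cell modules, the bimodule
isomorphisms `α_λ`, the elements `m_λ`, the cell filtrations of the restricted cell modules, the
branching factors `d_{λ → μ}` and the `u`-branching factors `u_{λ → μ}`.  (The values of `d` and
`u` on pairs that are not edges are irrelevant.) -/
structure DiagramTower (R 𝔽 B : Type*) [CommRing R] [Field 𝔽] [Algebra R 𝔽]
    [Ring B] [Algebra R B] (Λ : ℕ → Type*) [∀ r, PartialOrder (Λ r)]
    (S : ∀ r, Λ r → Type*) [∀ r l, Fintype (S r l)] extends CellularTower R B Λ S where
  /-- `A_0 = R`. -/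
  A_zero : Function.Bijective (algebraMap R (A 0))
  /-- The label set at level `0` is a singleton. -/
  root : Λ 0
  root_unique : ∀ l : Λ 0, l = root
  δ : ∀ r (l : Λ r), S r l → R
  /-- The cell modules are cyclic. -/
  δ_generates : ∀ r (l : Λ r) (x : S r l → R), ∃ a, (cell r).act l a (δ r l) = x
  α : ∀ r (l : Λ r), (cell r).BimoduleIso l
  m : ∀ r (l : Λ r), (cell r).aboveEq l
  α_m : ∀ r (l : Λ r), (α r l).toFun (m r l) = δ r l ⊗ₜ[R] δ r l
  m_star : ∀ r (l : Λ r), inv.toFun ((m r l : A r) : B) = ((m r l : A r) : B)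
  m_root : ((m 0 root : A 0) : B) = 1
  /-- `A_r ⊗ 𝔽` is split semisimple. -/
  splitSemisimple : ∀ r, IsSplitSemisimple 𝔽 (𝔽 ⊗[R] (A r))
  /-- Restriction coherence. -/
  filtration : ∀ r (μ : Λ (r + 1)),
    (cell r).CellFiltration (toCellularTower.resAct r μ)
  d : ∀ r, Λ r → ∀ _ : Λ (r + 1), A (r + 1)
  /-- Let `0 = M_0 ⊆ ⋯ ⊆ M_n = Δ_{r+1}(μ)` be the filtration.  If `M_{i+1} / M_i ≅ Δ_r(λ)`, then
  `δ_{r+1}(μ) d_{λ → μ}` lies in `M_{i+1}` and its class corresponds to `δ_r(λ)`. -/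
  d_spec : ∀ r (μ : Λ (r + 1)) (i : Fin (filtration r μ).n),
    ∃ h : (cell (r + 1)).act μ (d r ((filtration r μ).label i) μ) (δ (r + 1) μ) ∈
        (filtration r μ).sub i.succ,
      (filtration r μ).proj i ⟨_, h⟩ = δ r ((filtration r μ).label i)
  u : ∀ r, Λ r → ∀ _ : Λ (r + 1), A (r + 1)
  /-- `m_μ d_{λ → μ} = (u_{λ → μ})* m_λ` for every edge `λ → μ`. -/
  compat : ∀ r (l : Λ r) (μ : Λ (r + 1)), toCellularTower.Edge r l μ →
    ((m (r + 1) μ : A (r + 1)) : B) * (d r l μ : B) =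
      inv.toFun (u r l μ : B) * ((m r l : A r) : B)

namespace DiagramTower

variable {R 𝔽 B : Type*} [CommRing R] [Field 𝔽] [Algebra R 𝔽]
    [Ring B] [Algebra R B] {Λ : ℕ → Type*} [∀ r, PartialOrder (Λ r)]
    {S : ∀ r, Λ r → Type*} [∀ r l, Fintype (S r l)]

/-- `u_t = u_{t(0) → t(1)} u_{t(1) → t(2)} ⋯ u_{t(r-1) → t(r)}`. -/
noncomputable def uPath (T : DiagramTower R 𝔽 B Λ S) {r : ℕ}
    (t : T.toCellularTower.Tableau r) : B :=
  (List.ofFn fun j : Fin r =>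
    (T.u j (t.vertex j j.2.le) (t.vertex (j + 1) j.2) : B)).prod

/-- `u_t*`, the representative of the Murphy basis element `m_t`. -/
noncomputable def uStar (T : DiagramTower R 𝔽 B Λ S) {r : ℕ}
    (t : T.toCellularTower.Tableau r) : B :=
  T.inv.toFun (T.uPath t)

end DiagramTower

/-! Since u_t* = m_ν d_t and δ a ↦ m_ν a embeds Δ_r(ν) into A_r modulo A_r^{▷ν}, the claim concerns
the expansion of δ d_t x in the vectors δ d_w, which span Δ_r(ν) (`span_act_dPath`). It suffices
that the coefficient c_w vanishes for each bad w, one whose truncation to [0, s] does not dominate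
that of t.

Coefficients are detected by multiples F_w in A_r (`pathProj`) of Gelfand–Zeitlin idempotents:
products of one central element z_{w(j)} of A_j for each level j. As m_λ z_κ = 0 unless κ ⊵ λ, one
gets u_v* F_w = 0 unless w ⊵ v (`uStar_mul_central`), while δ d_w F_w ≠ 0. An x commuting with A_s
slides past the z_{w(j)} with j ≤ s, so u_t* x F_w = 0 for bad w. For a minimal bad w with c_w ≠ 0,
multiplying the expansion by F_w leaves c_w δ d_w F_w = 0, a contradiction.

Split semisimplicity over 𝔽 makes A_r act faithfully on the sum of its cell modules
(`eq_zero_of_act_eq_zero`), so that A_r contains nonzero multiples of the central idempotents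
(`exists_central`). -/

/-- If a power of `a` annihilates each element of `s`, then also each element of the span. -/
theorem exists_mul_pow_eq_zero_of_mem_span {R A : Type*} [CommRing R] [Ring A] [Algebra R A]
    {s : Set A} {a y : A} (h : ∀ y ∈ s, ∃ N, y * a ^ N = 0) (hy : y ∈ Submodule.span R s) :
    ∃ N, y * a ^ N = 0 := by
  induction hy using Submodule.span_induction with
  | mem y hy => exact h y hy
  | zero => exact ⟨0, by simp⟩
  | add x y _ _ hx hy =>
    obtain ⟨N, hN⟩ := hx
    obtain ⟨N', hN'⟩ := hy
    refine ⟨N + N', ?_⟩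
    rw [add_mul, pow_add, ← mul_assoc, hN, zero_mul, ← pow_add, add_comm N, pow_add, ← mul_assoc,
      hN', zero_mul, zero_add]
  | smul k x _ hx =>
    obtain ⟨N, hN⟩ := hx
    exact ⟨N, by rw [smul_mul_assoc, hN, smul_zero]⟩

/-! ### Cell ideals and their action on cell modules -/

namespace CellDatum

variable {R A : Type*} [CommRing R] [Ring A] [Algebra R A] {inv : AlgInvolution R A}
  {Λ : Type*} [PartialOrder Λ] {S : Λ → Type*} [∀ l, Fintype (S l)]

theorem above_le_aboveEq (D : CellDatum R A inv Λ S) {l μ : Λ} (h : l ≤ μ) :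
    D.above μ ≤ D.aboveEq l := by
  refine Submodule.span_mono ?_
  rintro _ ⟨κ, p, q, hκ, rfl⟩
  exact ⟨κ, p, q, h.trans hκ.le, rfl⟩

theorem aboveEq_mul (D : CellDatum R A inv Λ S) (l : Λ) {y : A} (hy : y ∈ D.aboveEq l) (a : A) :
    y * a ∈ D.aboveEq l := by
  unfold aboveEq at hy
  induction hy using Submodule.span_induction with
  | mem y h =>
    obtain ⟨μ, p, q, hle, rfl⟩ := h
    have h2 := D.above_le_aboveEq hle (D.coeff_spec μ a p q)
    have h3 : ∑ v, D.coeff μ a q v • D.c ⟨μ, (p, v)⟩ ∈ D.aboveEq l :=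
      Submodule.sum_mem _ fun v _ => Submodule.smul_mem _ _
        (Submodule.subset_span ⟨μ, p, v, hle, rfl⟩)
    simpa using Submodule.add_mem _ h2 h3
  | zero => simp
  | add x y _ _ hx hy =>
    rw [add_mul]
    exact Submodule.add_mem _ hx hy
  | smul k x _ hx =>
    rw [smul_mul_assoc]
    exact Submodule.smul_mem _ _ hx

theorem star_mem_aboveEq (D : CellDatum R A inv Λ S) (l : Λ) {y : A} (hy : y ∈ D.aboveEq l) :
    inv.toFun y ∈ D.aboveEq l := by
  unfold aboveEq at hy
  induction hy using Submodule.span_induction with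
  | mem y h =>
    obtain ⟨μ, p, q, hle, rfl⟩ := h
    have h2 : inv.toFun (D.c ⟨μ, (p, q)⟩) - D.c ⟨μ, (q, p)⟩ ∈ D.aboveEq l :=
      D.above_le_aboveEq hle (D.star_basis μ p q)
    have h3 : D.c ⟨μ, (q, p)⟩ ∈ D.aboveEq l := Submodule.subset_span ⟨μ, q, p, hle, rfl⟩
    simpa using Submodule.add_mem _ h2 h3
  | zero => simp
  | add x y _ _ hx hy =>
    rw [map_add]
    exact Submodule.add_mem _ hx hy
  | smul k x _ hx =>
    rw [map_smul]
    exact Submodule.smul_mem _ _ hx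

/-- The cell datum only controls right multiplication; the left version follows from a y = (y* a*)*.
-/
theorem mul_aboveEq (D : CellDatum R A inv Λ S) (l : Λ) {y : A} (hy : y ∈ D.aboveEq l) (a : A) :
    a * y ∈ D.aboveEq l := by
  have h := D.star_mem_aboveEq l (D.aboveEq_mul l (D.star_mem_aboveEq l hy) (inv.toFun a))
  rwa [inv.map_mul, inv.invol, inv.invol] at h

theorem repr_aboveEq (D : CellDatum R A inv Λ S) {l κ : Λ} (hκ : ¬ l ≤ κ) {y : A}
    (hy : y ∈ D.aboveEq l) (p q : S κ) : D.c.repr y ⟨κ, (p, q)⟩ = 0 := by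
  classical
  unfold aboveEq at hy
  induction hy using Submodule.span_induction with
  | mem y h =>
    obtain ⟨μ, p', q', hle, rfl⟩ := h
    rw [D.c.repr_self, Finsupp.single_apply, if_neg]
    intro h
    obtain rfl : μ = κ := congrArg Sigma.fst h
    exact hκ hle
  | zero => simp
  | add x y _ _ hx hy => simp [hx, hy]
  | smul k x _ hx => simp [hx]

theorem act_apply (D : CellDatum R A inv Λ S) (l : Λ) (a : A) (x : S l → R) (v : S l) :
    D.act l a x v = ∑ t, x t * D.coeff l a t v := rfl

theorem coeff_eq_act (D : CellDatum R A inv Λ S) [∀ l, DecidableEq (S l)] (l : Λ) (a : A)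
    (t v : S l) : D.coeff l a t v = D.act l a (Pi.single t 1) v := by
  rw [act_apply, Finset.sum_eq_single t]
  · simp
  · intro w _ hw
    simp [hw]
  · simp

/-- Elements of `A^{⊵λ}` act on `Δ(κ)` by zero unless `κ ⊵ λ`. -/
theorem act_eq_zero_of_mem_aboveEq (D : CellDatum R A inv Λ S) {l κ : Λ} (hκ : ¬ l ≤ κ) {y : A}
    (hy : y ∈ D.aboveEq l) : D.act κ y = 0 := by
  ext x v
  -- The coefficient is read off `c_{tt} y`, which stays in the two-sided ideal A^{⊵λ} and so has no
  -- κ-component.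
  have h : ∀ t, D.coeff κ y t v = 0 := fun t => D.repr_aboveEq hκ (D.mul_aboveEq l hy _) t v
  simp [act_apply, h]

/-- Multiplication by such an `a` pushes the layer of `l` strictly up the poset; by finiteness,
iterating it reaches zero. -/
theorem basis_mul_mem_above (D : CellDatum R A inv Λ S) {l : Λ} {a : A} (ha : D.act l a = 0)
    (s t : S l) : D.c ⟨l, (s, t)⟩ * a ∈ D.above l := by
  classical
  have h := D.coeff_spec l a s t
  simpa [D.coeff_eq_act, ha] using h

/-- An element that annihilates all the cell modules is nilpotent. -/
theorem isNilpotent_of_act_eq_zero [Finite Λ] (D : CellDatum R A inv Λ S) {a : A}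
    (ha : ∀ l, D.act l a = 0) : IsNilpotent a := by
  have key : ∀ l : Λ, ∀ p q, ∃ N, D.c ⟨l, (p, q)⟩ * a ^ N = 0 := by
    intro l
    induction l using (Finite.wellFounded_of_trans_of_irrefl (α := Λ) (· > ·)).induction with
    | h l ih =>
      intro p q
      obtain ⟨N, hN⟩ := exists_mul_pow_eq_zero_of_mem_span
        (by rintro _ ⟨μ, p, q, hlt, rfl⟩; exact ih μ hlt p q)
        (D.basis_mul_mem_above (ha l) p q)
      exact ⟨N + 1, by rw [pow_succ', ← mul_assoc, hN]⟩
  obtain ⟨N, hN⟩ := exists_mul_pow_eq_zero_of_mem_span (R := R) (s := Set.range D.c) (a := a)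
    (y := 1) (by rintro _ ⟨⟨l, p, q⟩, rfl⟩; exact key l p q) (by simp)
  exact ⟨N, by simpa using hN⟩

end CellDatum

/-! ### Denominators, semisimplicity and faithfulness -/

/-- Every element of `K ⊗ A` becomes an element of `A` after multiplication with a nonzero
denominator. -/
theorem exists_smul_eq_one_tmul {R K A : Type*} [CommRing R] [IsDomain R] [Field K] [Algebra R K]
    [IsFractionRing R K] [Ring A] [Algebra R A] (x : K ⊗[R] A) :
    ∃ (k : R) (a : A), k ≠ 0 ∧ k • x = 1 ⊗ₜ[R] a := by
  induction x using TensorProduct.induction_on with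
  | zero => exact ⟨1, 0, one_ne_zero, by simp⟩
  | tmul f a =>
    obtain ⟨p, q, hq, rfl⟩ := IsFractionRing.div_surjective (A := R) f
    have hq0 : q ≠ 0 := nonZeroDivisors.ne_zero hq
    have hq1 : algebraMap R K q ≠ 0 := by simpa using hq0
    refine ⟨q, p • a, hq0, ?_⟩
    rw [TensorProduct.tmul_smul, TensorProduct.smul_tmul', TensorProduct.smul_tmul']
    congr 1
    rw [Algebra.smul_def, Algebra.smul_def]
    field_simp
  | add x y hx hy =>
    obtain ⟨k, a, hk, hx⟩ := hx
    obtain ⟨k', a', hk', hy⟩ := hy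
    refine ⟨k * k', k' • a + k • a', mul_ne_zero hk hk', ?_⟩
    rw [smul_add, TensorProduct.tmul_add, TensorProduct.tmul_smul, TensorProduct.tmul_smul, ← hx,
      ← hy, smul_smul, smul_smul, mul_comm k' k]

/-- A split semisimple algebra has no nonzero nil left ideal. -/
theorem IsSplitSemisimple.eq_zero_of_forall_isNilpotent {K A : Type*} [Field K] [Ring A]
    [Algebra K A] (h : IsSplitSemisimple K A) {a : A} (ha : ∀ b, IsNilpotent (b * a)) :
    a = 0 := by
  obtain ⟨n, d, -, ⟨e⟩⟩ := h
  apply e.injective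
  rw [map_zero]
  ext i p q
  by_contra hne
  -- Multiplying by E_{qp} on the left moves the entry (p, q) of block i to the diagonal position
  -- (q, q) and clears the other rows, so powers of the product have the powers of that entry there.
  obtain ⟨N, hN⟩ := ha (e.symm (Pi.single i (Matrix.single q p 1)))
  have h1 := congrArg (fun y => e y i) hN
  simp only [map_pow, map_mul, AlgEquiv.apply_symm_apply, map_zero, Pi.zero_apply, Pi.pow_apply,
    Pi.mul_apply, Pi.single_eq_same] at h1
  have h2 : ∀ k : ℕ, ((Matrix.single q p (1 : K) * e a i) ^ k : Matrix _ _ K) q q =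
      (e a i p q) ^ k := by
    intro k
    induction k with
    | zero => simp
    | succ k ih =>
      rw [pow_succ, Matrix.mul_apply, Finset.sum_eq_single q, ih, Matrix.single_mul_apply_same,
        one_mul, pow_succ]
      · intro j _ hj
        rw [Matrix.single_mul_apply_of_ne _ _ _ _ _ hj, mul_zero]
      · simp
  have h3 := congrFun (congrFun h1 q) q
  rw [h2] at h3
  exact hne (by simpa using eq_zero_of_pow_eq_zero h3)

namespace CellDatum

variable {R A : Type*} [CommRing R] [Ring A] [Algebra R A] {inv : AlgInvolution R A}
  {Λ : Type*} [PartialOrder Λ] {S : Λ → Type*} [∀ l, Fintype (S l)]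

/-- If the algebra is split semisimple over the field of fractions, then it acts faithfully on
the sum of the cell modules. -/
theorem eq_zero_of_act_eq_zero [IsDomain R] [Finite Λ] (K : Type*) [Field K] [Algebra R K]
    [IsFractionRing R K] (D : CellDatum R A inv Λ S) (hK : IsSplitSemisimple K (K ⊗[R] A)) {a : A}
    (ha : ∀ l, D.act l a = 0) : a = 0 := by
  have h0 : (1 : K) ⊗ₜ[R] a = 0 := by
    -- The left ideal of 1 ⊗ a is nil: up to a denominator its elements come from b' a, which kills
    -- every cell module.
    refine hK.eq_zero_of_forall_isNilpotent fun b => ?_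
    obtain ⟨k, b', hk, hb⟩ := exists_smul_eq_one_tmul b
    have hn : IsNilpotent (b' * a) := by
      refine D.isNilpotent_of_act_eq_zero fun l => ?_
      ext x v
      simp [D.act_mul, ha]
    obtain ⟨N, hN⟩ := hn
    refine ⟨N, ?_⟩
    have h1 : (k • (b * (1 : K) ⊗ₜ[R] a)) ^ N = 0 := by
      rw [← smul_mul_assoc, hb, Algebra.TensorProduct.tmul_mul_tmul, Algebra.TensorProduct.tmul_pow,
        hN, TensorProduct.tmul_zero]
    have hk' : algebraMap R K (k ^ N) ≠ 0 := by simpa using fun h => (hk h).elim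
    rw [smul_pow, algebra_compatible_smul K] at h1
    exact (smul_eq_zero.1 h1).resolve_left hk'
  apply D.c.repr.injective
  ext i
  have h1 := congrArg (fun y => (D.c.baseChange K).repr y i) h0
  simpa using h1

/-- The algebra contains, up to a common denominator, every endomorphism of the sum of the cell
modules. -/
theorem exists_coeff_eq [IsDomain R] [Finite Λ] (K : Type*) [Field K] [Algebra R K]
    [IsFractionRing R K] (D : CellDatum R A inv Λ S) (hK : IsSplitSemisimple K (K ⊗[R] A)) :
    ∃ k : R, k ≠ 0 ∧ ∀ y : (Σ l, S l × S l) → R, ∃ z : A, ∀ l t v,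
      D.coeff l z t v = k * y ⟨l, (t, v)⟩ := by
  classical
  have := Fintype.ofFinite Λ
  -- Both sides are free on the same index set, so the matrix of Ψ is square. Faithfulness makes its
  -- determinant nonzero, and the adjugate inverts Ψ up to that determinant, which serves as k.
  let Ψ : A →ₗ[R] ((Σ l, S l × S l) → R) :=
    { toFun := fun a i => D.coeff i.1 a i.2.1 i.2.2
      map_add' := fun a b => by
        funext i
        simp [coeff, mul_add]
      map_smul' := fun k a => by
        funext i
        simp [coeff] }
  let M := LinearMap.toMatrix D.c (Pi.basisFun R (Σ l, S l × S l)) Ψ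
  have hM : ∀ x, M.mulVec x = Ψ (D.c.equivFun.symm x) := by
    intro x
    have h := LinearMap.toMatrix_mulVec_repr D.c (Pi.basisFun R (Σ l, S l × S l)) Ψ
      (D.c.equivFun.symm x)
    have h2 : ⇑(D.c.repr (D.c.equivFun.symm x)) = x := D.c.equivFun.apply_symm_apply x
    rw [h2] at h
    rw [h]
    funext i
    simp
  have hdet : M.det ≠ 0 := by
    intro h
    obtain ⟨x, hx, h⟩ := Matrix.exists_mulVec_eq_zero_iff.2 h
    rw [hM] at h
    apply hx
    have h3 : D.c.equivFun.symm x = 0 := by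
      refine D.eq_zero_of_act_eq_zero K hK fun l => ?_
      refine LinearMap.ext fun t => funext fun v => ?_
      have : D.coeff l (D.c.equivFun.symm x) = 0 := by
        funext t v
        exact congrFun h ⟨l, (t, v)⟩
      rw [act_apply, this]
      simp
    exact D.c.equivFun.symm.map_eq_zero_iff.1 h3
  refine ⟨M.det, hdet, fun y => ⟨D.c.equivFun.symm (M.adjugate.mulVec y), fun l t v => ?_⟩⟩
  have h := hM (M.adjugate.mulVec y)
  rw [Matrix.mulVec_mulVec, Matrix.mul_adjugate, Matrix.smul_mulVec, Matrix.one_mulVec] at h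
  exact (congrFun h ⟨l, (t, v)⟩).symm

/-- A multiple of the central idempotent that belongs to the cell module `Δ(λ)`. -/
theorem exists_central [IsDomain R] [Finite Λ] (K : Type*) [Field K] [Algebra R K]
    [IsFractionRing R K] (D : CellDatum R A inv Λ S) (hK : IsSplitSemisimple K (K ⊗[R] A))
    (l : Λ) : ∃ (z : A) (k : R), k ≠ 0 ∧ (∀ x, D.act l z x = k • x) ∧
      (∀ μ, μ ≠ l → D.act μ z = 0) ∧ ∀ a, a * z = z * a := by
  classical
  obtain ⟨k, hk, h⟩ := D.exists_coeff_eq K hK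
  -- The target is the identity matrix in block `l` and zero in the other blocks.
  obtain ⟨z, hz⟩ := h fun i => if i.1 = l ∧ i.2.1 = i.2.2 then 1 else 0
  have h1 : ∀ x, D.act l z x = k • x := by
    intro x
    funext v
    simp [act_apply, hz, mul_comm]
  have h2 : ∀ μ, μ ≠ l → D.act μ z = 0 := by
    intro μ hμ
    ext x v
    simp [act_apply, hz, hμ]
  refine ⟨z, k, hk, h1, h2, fun a => sub_eq_zero.1 (D.eq_zero_of_act_eq_zero K hK fun μ => ?_)⟩
  refine LinearMap.ext fun x => ?_
  rw [map_sub, LinearMap.sub_apply, D.act_mul, D.act_mul]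
  by_cases hμ : μ = l
  · subst hμ
    simp [h1]
  · simp [h2 μ hμ]

end CellDatum

/-- Pure tensors of nonzero vectors in free modules over a domain are nonzero. -/
theorem eq_zero_of_tmul_eq_zero {R ι κ : Type*} [CommRing R] [IsDomain R] {x : ι → R} {y : κ → R}
    (hx : x ≠ 0) (h : x ⊗ₜ[R] y = 0) : y = 0 := by
  obtain ⟨i, hi⟩ := Function.ne_iff.1 hx
  funext j
  have h1 := congrArg (fun z => LinearMap.mul' R R
    (TensorProduct.map (LinearMap.proj i) (LinearMap.proj j) z)) h
  simpa using (mul_eq_zero.1 (by simpa using h1 : x i * y j = 0)).resolve_left hi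

theorem AlgInvolution.map_one {R A : Type*} [CommRing R] [Ring A] [Algebra R A]
    (inv : AlgInvolution R A) : inv.toFun 1 = 1 := by
  have h := inv.map_mul 1 (inv.toFun 1)
  rw [one_mul, inv.invol, one_mul] at h
  exact h.symm

/-! ### Paths in the branching diagram -/

namespace CellularTower

variable {R B : Type*} [CommRing R] [Ring B] [Algebra R B]
    {Λ : ℕ → Type*} [∀ r, PartialOrder (Λ r)]
    {S : ∀ r, Λ r → Type*} [∀ r l, Fintype (S r l)]

/-- The inclusion of `A r` into `A (r + 1)`. -/
def incl (T : CellularTower R B Λ S) (r : ℕ) : T.A r →ₐ[R] T.A (r + 1) :=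
  Subalgebra.inclusion (T.mono (Nat.le_succ r))

theorem coe_incl (T : CellularTower R B Λ S) (r : ℕ) (a : T.A r) :
    ((T.incl r a : T.A (r + 1)) : B) = a := rfl

theorem resAct_apply (T : CellularTower R B Λ S) (r : ℕ) (μ : Λ (r + 1)) (a : T.A r) :
    T.resAct r μ a = (T.cell (r + 1)).act μ (T.incl r a) := rfl

theorem exists_tableau_zero (T : CellularTower R B Λ S) (ν : Λ 0) :
    ∃ w : T.Tableau 0, w.vertex 0 le_rfl = ν :=
  ⟨⟨fun _ hj => (Nat.le_zero.1 hj) ▸ ν, fun _ h => absurd h (Nat.not_succ_le_zero _)⟩, rfl⟩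

/-- A path can be extended by an edge. -/
theorem exists_tableau_succ (T : CellularTower R B Λ S) {r : ℕ} (w : T.Tableau r)
    (μ : Λ (r + 1)) (h : T.Edge r (w.vertex r le_rfl) μ) :
    ∃ w' : T.Tableau (r + 1), w'.vertex (r + 1) le_rfl = μ ∧ w'.trunc r (Nat.le_succ r) = w := by
  -- The only new index is r + 1; this equation transports μ to the type `Λ j`.
  have hc : ∀ j, j ≤ r + 1 → ¬ j ≤ r → r + 1 = j := fun j h1 h2 => by omega
  have h0 : ∀ j (hj : j ≤ r + 1) (h : j ≤ r),
      (if h : j ≤ r then w.vertex j h else hc j hj h ▸ μ) = w.vertex j h :=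
    fun j hj h => dif_pos h
  have h1 : (if h : r + 1 ≤ r then w.vertex (r + 1) h else hc (r + 1) le_rfl h ▸ μ) = μ :=
    dif_neg (Nat.not_succ_le_self r)
  refine ⟨⟨fun j hj => if h : j ≤ r then w.vertex j h else hc j hj h ▸ μ, fun j hj => ?_⟩, h1, ?_⟩
  · rcases Nat.lt_or_ge j r with hjr | hjr
    · rw [h0 j (by omega) hjr.le, h0 (j + 1) hj hjr]
      exact w.edge j hjr
    · obtain rfl : j = r := by omega
      rw [h0 j (by omega) le_rfl, h1]
      exact h
  · ext j hj
    exact h0 j (by omega) hj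

end CellularTower

/-! ### The elements d_t and a spanning set of the cell module -/

namespace DiagramTower

variable {R 𝔽 B : Type*} [CommRing R] [Field 𝔽] [Algebra R 𝔽]
    [Ring B] [Algebra R B] {Λ : ℕ → Type*} [∀ r, PartialOrder (Λ r)]
    {S : ∀ r, Λ r → Type*} [∀ r l, Fintype (S r l)]

/-- `d_t = d_{t(r-1) → t(r)} ⋯ d_{t(0) → t(1)}`. -/
noncomputable def dPath (T : DiagramTower R 𝔽 B Λ S) :
    ∀ r, T.toCellularTower.Tableau r → T.A r
  | 0, _ => 1
  | r + 1, t => T.d r (t.vertex r (Nat.le_succ r)) (t.vertex (r + 1) le_rfl) *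
      T.incl r (T.dPath r (t.trunc r (Nat.le_succ r)))

theorem uStar_succ (T : DiagramTower R 𝔽 B Λ S) {r : ℕ} (t : T.toCellularTower.Tableau (r + 1)) :
    T.uStar t = T.inv.toFun (T.u r (t.vertex r (Nat.le_succ r)) (t.vertex (r + 1) le_rfl) : B) *
      T.uStar (t.trunc r (Nat.le_succ r)) := by
  rw [uStar, uPath, List.ofFn_succ', List.concat_eq_append, List.prod_append, T.inv.map_mul,
    List.prod_singleton]
  rfl

/-- Compatibility moves m down one level at a time, turning each d-factor into the corresponding u*,
until m_∅ = 1 is reached. -/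
theorem m_mul_dPath (T : DiagramTower R 𝔽 B Λ S) {r : ℕ} (t : T.toCellularTower.Tableau r) :
    ((T.m r (t.vertex r le_rfl) : T.A r) : B) * (T.dPath r t : B) = T.uStar t := by
  induction r with
  | zero =>
    have h : T.uStar t = 1 := by
      rw [uStar, uPath, List.ofFn_zero, List.prod_nil, AlgInvolution.map_one]
    rw [h, T.root_unique (t.vertex 0 le_rfl), T.m_root, dPath]
    simp
  | succ r ih =>
    rw [uStar_succ, ← ih, ← mul_assoc, dPath, Subalgebra.coe_mul, ← mul_assoc]
    change _ = T.inv.toFun _ * ((T.m r (t.vertex r _) : T.A r) : B) * _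
    rw [← T.compat r _ _ (t.edge r le_rfl)]
    rfl

/-- Cell data may have empty index sets, so zero cell modules have to be excluded. -/
theorem δ_ne_zero [IsDomain R] (T : DiagramTower R 𝔽 B Λ S) {r : ℕ} {l : Λ r}
    (h : Nonempty (S r l)) : T.δ r l ≠ 0 := by
  intro h0
  obtain ⟨a, ha⟩ := T.δ_generates r l 1
  rw [h0, map_zero] at ha
  obtain ⟨i⟩ := h
  simpa using congrFun ha i

/-- `a ↦ m_λ a` induces an injective map on the cell module `Δ(λ)`. -/
theorem m_mul_mem_above_iff [IsDomain R] (T : DiagramTower R 𝔽 B Λ S) {r : ℕ} (l : Λ r)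
    (a : T.A r) :
    (T.m r l : T.A r) * a ∈ (T.cell r).above l ↔ (T.cell r).act l a (T.δ r l) = 0 := by
  have hm := (T.cell r).aboveEq_mul l (T.m r l).2 a
  have h := (T.α r l).map_mul_right (T.m r l) ⟨_, hm⟩ a rfl
  rw [T.α_m, TensorProduct.map_tmul, LinearMap.id_apply] at h
  have hk := (T.α r l).ker ⟨_, hm⟩
  rw [h] at hk
  rw [← hk]
  refine ⟨fun h0 => ?_, fun h0 => by rw [h0, TensorProduct.tmul_zero]⟩
  rcases isEmpty_or_nonempty (S r l) with hS | hS
  · exact Subsingleton.elim _ _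
  · exact eq_zero_of_tmul_eq_zero (T.δ_ne_zero hS) h0

/-- The vectors `δ d_w`, where `w` runs through the paths that end in `ν`, span the cell module. -/
theorem span_act_dPath (T : DiagramTower R 𝔽 B Λ S) (r : ℕ) (ν : Λ r) :
    Submodule.span R {y | ∃ w : T.toCellularTower.Tableau r, w.vertex r le_rfl = ν ∧
      y = (T.cell r).act ν (T.dPath r w) (T.δ r ν)} = ⊤ := by
  induction r with
  | zero =>
    rw [eq_top_iff]
    rintro x -
    obtain ⟨a, rfl⟩ := T.δ_generates 0 ν x
    obtain ⟨k, rfl⟩ := T.A_zero.2 a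
    obtain ⟨w, hw⟩ := T.exists_tableau_zero ν
    have h : T.dPath 0 w = 1 := rfl
    rw [Algebra.algebraMap_eq_smul_one, map_smul, LinearMap.smul_apply]
    exact Submodule.smul_mem _ _ (Submodule.subset_span ⟨w, hw, by rw [h]⟩)
  | succ r ih =>
    set V := Submodule.span R {y | ∃ w : T.toCellularTower.Tableau (r + 1),
      w.vertex (r + 1) le_rfl = ν ∧
        y = (T.cell (r + 1)).act ν (T.dPath (r + 1) w) (T.δ (r + 1) ν)}
    set M := T.filtration r ν
    have key : ∀ i, M.sub i ≤ V := by
      intro i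
      induction i using Fin.induction with
      | zero => simp [M.sub_zero]
      | succ i ihi =>
        -- Each vector of the i-th subquotient lifts into V: by induction the δ_r d_w span it, and
        -- δ_{r+1} d_{λ → ν} d_w is a lift of δ_r d_w.
        have h1 : ∀ y, ∃ x : M.sub i.succ, (x : S (r + 1) ν → R) ∈ V ∧ M.proj i x = y := by
          intro y
          have hy : y ∈ (⊤ : Submodule R (S r (M.label i) → R)) := trivial
          rw [← ih (M.label i)] at hy
          induction hy using Submodule.span_induction with
          | mem y hy =>
            obtain ⟨w, hw, rfl⟩ := hy
            obtain ⟨h, hp⟩ := T.d_spec r ν i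
            obtain ⟨w', hw', rfl⟩ := T.exists_tableau_succ w ν ⟨M, i, hw.symm⟩
            refine ⟨⟨_, M.stable i.succ _ h (T.dPath r (w'.trunc r (Nat.le_succ r)))⟩, ?_, ?_⟩
            · refine Submodule.subset_span ⟨w', hw', ?_⟩
              have hw2 : w'.vertex r (Nat.le_succ r) = M.label i := hw
              rw [dPath, hw2, hw', CellDatum.act_mul]
              rfl
            · rw [M.proj_act i ⟨_, h⟩, hp]
          | zero => exact ⟨0, by simp, by simp⟩
          | add y y' _ _ hy hy' =>
            obtain ⟨x, hx, rfl⟩ := hy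
            obtain ⟨x', hx', rfl⟩ := hy'
            exact ⟨x + x', add_mem hx hx', map_add _ _ _⟩
          | smul k y _ hy =>
            obtain ⟨x, hx, rfl⟩ := hy
            exact ⟨k • x, V.smul_mem k hx, map_smul _ _ _⟩
        intro x hx
        obtain ⟨x', hx', h⟩ := h1 (M.proj i ⟨x, hx⟩)
        have h2 : M.proj i (⟨x, hx⟩ - x') = 0 := by rw [map_sub, h, sub_self]
        have h3 := ihi ((M.proj_ker i _).1 h2)
        simpa using add_mem h3 hx'
    rw [eq_top_iff, ← M.sub_last]
    exact key _

/-! ### Gelfand–Zeitlin elements and triangularity -/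

section Central

variable [IsDomain R] [IsFractionRing R 𝔽] [∀ r, Finite (Λ r)]

/-- A multiple of the central idempotent of `A_r ⊗ 𝔽` that belongs to `Δ_r(λ)`. -/
noncomputable def central (T : DiagramTower R 𝔽 B Λ S) (r : ℕ) (l : Λ r) : T.A r :=
  ((T.cell r).exists_central 𝔽 (T.splitSemisimple r) l).choose

theorem central_spec (T : DiagramTower R 𝔽 B Λ S) (r : ℕ) (l : Λ r) :
    ∃ k : R, k ≠ 0 ∧ (∀ x, (T.cell r).act l (T.central r l) x = k • x) ∧
      (∀ μ, μ ≠ l → (T.cell r).act μ (T.central r l) = 0) ∧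
        ∀ a, a * T.central r l = T.central r l * a :=
  ((T.cell r).exists_central 𝔽 (T.splitSemisimple r) l).choose_spec

theorem act_central_of_ne (T : DiagramTower R 𝔽 B Λ S) {r : ℕ} {l μ : Λ r} (h : μ ≠ l) :
    (T.cell r).act μ (T.central r l) = 0 :=
  (T.central_spec r l).choose_spec.2.2.1 μ h

theorem commute_central (T : DiagramTower R 𝔽 B Λ S) {r : ℕ} (l : Λ r) (a : T.A r) :
    Commute a (T.central r l) :=
  (T.central_spec r l).choose_spec.2.2.2 a

/-- By faithfulness: on Δ(κ) the factor m_l acts by zero, and on the other cell modules the central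
factor does. -/
theorem m_mul_central (T : DiagramTower R 𝔽 B Λ S) {r : ℕ} {l κ : Λ r} (h : ¬ l ≤ κ) :
    (T.m r l : T.A r) * T.central r κ = 0 := by
  refine (T.cell r).eq_zero_of_act_eq_zero 𝔽 (T.splitSemisimple r) fun μ => ?_
  refine LinearMap.ext fun x => ?_
  rw [CellDatum.act_mul]
  by_cases hμ : μ = κ
  · subst hμ
    rw [(T.cell r).act_eq_zero_of_mem_aboveEq h (T.m r l).2]
    simp
  · simp [T.act_central_of_ne hμ]

/-- Dominance triangularity. -/
theorem uStar_mul_central (T : DiagramTower R 𝔽 B Λ S) {r : ℕ} (w : T.toCellularTower.Tableau r)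
    {j : ℕ} (hj : j ≤ r) {κ : Λ j} (h : ¬ w.vertex j hj ≤ κ) :
    T.uStar w * (T.central j κ : B) = 0 := by
  induction r with
  | zero =>
    obtain rfl := Nat.le_zero.1 hj
    rw [← T.m_mul_dPath, ← Subalgebra.coe_mul, ← Subalgebra.coe_mul, mul_assoc,
      (T.commute_central κ _).eq, ← mul_assoc, T.m_mul_central h]
    simp
  | succ r ih =>
    rcases Nat.lt_or_ge r j with hjr | hjr
    · obtain rfl : j = r + 1 := by omega
      -- At the top level the central element moves left past d_w to meet m.
      rw [← T.m_mul_dPath, ← Subalgebra.coe_mul, ← Subalgebra.coe_mul, mul_assoc,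
        (T.commute_central κ _).eq, ← mul_assoc, T.m_mul_central h]
      simp
    · rw [uStar_succ, mul_assoc, ih (w.trunc r (Nat.le_succ r)) hjr h, mul_zero]

/-- A label with nonzero cell module that occurs in some cell filtration occurs in the chosen
one. -/
theorem exists_label_eq (T : DiagramTower R 𝔽 B Λ S) {r : ℕ} {l : Λ r} {μ : Λ (r + 1)}
    (h : T.toCellularTower.Edge r l μ) (hS : Nonempty (S r l)) :
    ∃ i, (T.filtration r μ).label i = l := by
  by_contra! hne
  obtain ⟨k, hk, hz, -⟩ := T.central_spec r l
  set z := T.central r l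
  set M := T.filtration r μ
  -- If `l` were not a label, z would map each M_{i+1} into M_i, hence act nilpotently.
  have h1 : ∀ i, ∀ x ∈ M.sub i, ∃ n : ℕ, (T.resAct r μ z ^ n) x = 0 := by
    intro i
    induction i using Fin.induction with
    | zero =>
      intro x hx
      rw [M.sub_zero, Submodule.mem_bot] at hx
      exact ⟨0, by simpa using hx⟩
    | succ i ih =>
      intro x hx
      have h2 := M.proj_act i ⟨x, hx⟩ z
      rw [T.act_central_of_ne (hne i), LinearMap.zero_apply, M.proj_ker] at h2
      obtain ⟨n, hn⟩ := ih _ h2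
      exact ⟨n + 1, by rw [pow_succ, Module.End.mul_apply, hn]⟩
  obtain ⟨N, i, rfl⟩ := h
  obtain ⟨x, hx⟩ := N.proj_surjective i 1
  -- In the other filtration z acts on the subquotient Δ(l) by k ≠ 0, so its powers cannot kill a
  -- lift of a nonzero vector.
  have h3 : ∀ n : ℕ, ∃ y : N.sub i.succ, (y : S (r + 1) μ → R) = (T.resAct r μ z ^ n) x ∧
      N.proj i y = k ^ n • 1 := by
    intro n
    induction n with
    | zero => exact ⟨x, by simp, by simp [hx]⟩
    | succ n ih =>
      obtain ⟨y, hy, hp⟩ := ih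
      refine ⟨⟨_, N.stable _ _ y.2 z⟩, ?_, ?_⟩
      · rw [pow_succ', Module.End.mul_apply, ← hy]
      · rw [N.proj_act, hp, hz, smul_smul, pow_succ']
  obtain ⟨n, hn⟩ := h1 (Fin.last _) x (by rw [M.sub_last]; trivial)
  obtain ⟨y, hy, hp⟩ := h3 n
  rw [hn, Submodule.coe_eq_zero] at hy
  obtain ⟨j⟩ := hS
  have h4 := congrFun hp j
  rw [hy] at h4
  exact pow_ne_zero n hk (by simpa using h4.symm)

/-- A multiple of the idempotent of the Gelfand–Zeitlin subalgebra that belongs to a path. -/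
noncomputable def pathProj (T : DiagramTower R 𝔽 B Λ S) :
    ∀ r, T.toCellularTower.Tableau r → T.A r
  | 0, t => T.central 0 (t.vertex 0 le_rfl)
  | r + 1, t => T.incl r (T.pathProj r (t.trunc r (Nat.le_succ r))) *
      T.central (r + 1) (t.vertex (r + 1) le_rfl)

/-- Each factor commutes with those of lower level, so any one can be brought to the front, where an
element on the left meets it. -/
theorem exists_pathProj_eq_central_mul (T : DiagramTower R 𝔽 B Λ S) {r : ℕ}
    (w : T.toCellularTower.Tableau r) {j : ℕ} (hj : j ≤ r) :
    ∃ g : B, (T.pathProj r w : B) = (T.central j (w.vertex j hj) : B) * g := by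
  induction r with
  | zero =>
    obtain rfl := Nat.le_zero.1 hj
    exact ⟨1, by rw [mul_one]; rfl⟩
  | succ r ih =>
    rcases Nat.lt_or_ge r j with hjr | hjr
    · obtain rfl : j = r + 1 := by omega
      refine ⟨(T.incl r (T.pathProj r (w.trunc r (Nat.le_succ r))) : T.A (r + 1)), ?_⟩
      rw [pathProj, (T.commute_central _ _).eq, Subalgebra.coe_mul]
    · obtain ⟨g, h⟩ := ih (w.trunc r (Nat.le_succ r)) hjr
      refine ⟨g * (T.central (r + 1) (w.vertex (r + 1) le_rfl) : B), ?_⟩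
      rw [pathProj, Subalgebra.coe_mul, CellularTower.coe_incl, h, mul_assoc]
      rfl

/-- The diagonal entry of the triangular system. The top central factor acts by a nonzero scalar,
and the projection to the subquotient takes δ_{r+1} d to δ_r, which reduces the claim to the
truncated path. -/
theorem act_dPath_mul_pathProj_ne_zero (T : DiagramTower R 𝔽 B Λ S) {r : ℕ}
    (w : T.toCellularTower.Tableau r) :
    (T.cell r).act (w.vertex r le_rfl) (T.dPath r w * T.pathProj r w)
      (T.δ r (w.vertex r le_rfl)) ≠ 0 := by
  induction r with
  | zero =>
    obtain ⟨k, hk, hz, -⟩ := T.central_spec 0 (w.vertex 0 le_rfl)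
    have hS : Nonempty (S 0 (w.vertex 0 le_rfl)) := by
      by_contra hS
      rw [not_nonempty_iff] at hS
      -- An empty index set at the root would give A_0 = 0, whereas A_0 = R is nontrivial.
      have : IsEmpty (Σ l, S 0 l × S 0 l) := by
        refine ⟨fun ⟨l, p, q⟩ => ?_⟩
        obtain rfl : l = w.vertex 0 le_rfl :=
          (T.root_unique _).trans (T.root_unique _).symm
        exact hS.false p
      have : Subsingleton (T.A 0) := (T.cell 0).c.repr.toEquiv.subsingleton
      exact one_ne_zero (T.A_zero.1 (Subsingleton.elim (algebraMap R (T.A 0) 1) (algebraMap R _ 0)))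
    rw [dPath, pathProj, one_mul, hz]
    exact smul_ne_zero hk (T.δ_ne_zero hS)
  | succ r ih =>
    obtain ⟨k, hk, hz, -⟩ := T.central_spec (r + 1) (w.vertex (r + 1) le_rfl)
    have hw := ih (w.trunc r (Nat.le_succ r))
    change (T.cell r).act (w.vertex r (Nat.le_succ r)) _
      (T.δ r (w.vertex r (Nat.le_succ r))) ≠ 0 at hw
    have hS : Nonempty (S r (w.vertex r (Nat.le_succ r))) := by
      by_contra hS
      rw [not_nonempty_iff] at hS
      exact hw (Subsingleton.elim _ _)
    obtain ⟨i, hi⟩ := T.exists_label_eq (w.edge r le_rfl) hS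
    obtain ⟨h, hp⟩ := T.d_spec r (w.vertex (r + 1) le_rfl) i
    rw [pathProj, dPath, ← mul_assoc, CellDatum.act_mul, hz, mul_assoc, ← map_mul,
      CellDatum.act_mul, ← hi, ← CellularTower.resAct_apply]
    rw [← hi] at hw
    refine smul_ne_zero hk fun h0 => hw ?_
    rw [← hp, ← CellDatum.CellFiltration.proj_act, CellDatum.CellFiltration.proj_ker]
    exact Set.mem_of_eq_of_mem h0 (zero_mem _)

end Central

end DiagramTower

/-! ### Paths with a fixed endpoint and the proposition -/

namespace DiagramTower

variable {R 𝔽 B : Type*} [CommRing R] [Field 𝔽] [Algebra R 𝔽]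
    [Ring B] [Algebra R B] {Λ : ℕ → Type*} [∀ r, PartialOrder (Λ r)]
    {S : ∀ r, Λ r → Type*} [∀ r l, Fintype (S r l)]

theorem m_mul_dPath_of_std (T : DiagramTower R 𝔽 B Λ S) {r : ℕ} {ν : Λ r}
    (w : T.toCellularTower.Std r ν) :
    ((T.m r ν : T.A r) : B) * (T.dPath r w.1 : B) = T.uStar w.1 := by
  obtain ⟨w, rfl⟩ := w
  exact T.m_mul_dPath w

/-- Transfers vanishing from the algebra to the cell module, through the injectivity of δ a ↦ m_ν a
modulo A^{▷ν}. -/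
theorem act_dPath_mul_eq_zero [IsDomain R] (T : DiagramTower R 𝔽 B Λ S) {r : ℕ} {ν : Λ r}
    (w : T.toCellularTower.Std r ν) {a : T.A r} (h : T.uStar w.1 * (a : B) = 0) :
    (T.cell r).act ν (T.dPath r w.1 * a) (T.δ r ν) = 0 := by
  rw [← T.m_mul_mem_above_iff]
  refine Set.mem_of_eq_of_mem (Subtype.ext ?_) (zero_mem _)
  rw [Subalgebra.coe_mul, Subalgebra.coe_mul, ← mul_assoc, T.m_mul_dPath_of_std, h]
  rfl

theorem exists_act_eq_sum [∀ r, Finite (Λ r)] (T : DiagramTower R 𝔽 B Λ S) (r : ℕ) (ν : Λ r)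
    (x : S r ν → R) : ∃ c : T.toCellularTower.Std r ν → R,
      ∑ w, c w • (T.cell r).act ν (T.dPath r w.1) (T.δ r ν) = x := by
  rw [← Submodule.mem_span_range_iff_exists_fun]
  have h : x ∈ (⊤ : Submodule R (S r ν → R)) := trivial
  rw [← T.span_act_dPath] at h
  refine Submodule.span_mono ?_ h
  rintro _ ⟨w, hw, rfl⟩
  exact ⟨⟨w, hw⟩, rfl⟩

section Central

variable [IsDomain R] [IsFractionRing R 𝔽] [∀ r, Finite (Λ r)]

theorem act_dPath_mul_pathProj_ne_zero_of_std (T : DiagramTower R 𝔽 B Λ S) {r : ℕ} {ν : Λ r}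
    (w : T.toCellularTower.Std r ν) :
    (T.cell r).act ν (T.dPath r w.1 * T.pathProj r w.1) (T.δ r ν) ≠ 0 := by
  obtain ⟨w, rfl⟩ := w
  exact T.act_dPath_mul_pathProj_ne_zero w

/-- If `x` commutes with `A_s`, then `u_t* x` is annihilated by the idempotents of the paths `w`
whose truncation to `[0, s]` does not dominate that of `t`. -/
theorem uStar_mul_mul_pathProj (T : DiagramTower R 𝔽 B Λ S) {s r : ℕ} (hsr : s ≤ r)
    (t w : T.toCellularTower.Tableau r) {x : B} (hcomm : ∀ y ∈ T.A s, x * y = y * x)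
    (h : ¬ t.trunc s hsr ≤ w.trunc s hsr) :
    T.uStar t * x * (T.pathProj r w : B) = 0 := by
  have h1 : ¬ ∀ j (hj : j ≤ s), t.vertex j (hj.trans hsr) ≤ w.vertex j (hj.trans hsr) := h
  push Not at h1
  obtain ⟨j, hj, hlt⟩ := h1
  obtain ⟨g, hg⟩ := T.exists_pathProj_eq_central_mul w (hj.trans hsr)
  -- The central element lies in A_j ⊆ A_s, so x moves past it and triangularity applies to u_t*.
  rw [hg, ← mul_assoc, mul_assoc _ x, hcomm _ (T.mono hj (Subtype.prop _)), ← mul_assoc,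
    T.uStar_mul_central t _ hlt, zero_mul, zero_mul]

end Central

end DiagramTower

open Classical in
theorem mainTheorem9 {R 𝔽 B : Type*} [CommRing R] [IsDomain R] [Field 𝔽] [Algebra R 𝔽]
    [IsFractionRing R 𝔽] [Ring B] [Algebra R B]
    {Λ : ℕ → Type*} [∀ r, PartialOrder (Λ r)] [∀ r, Finite (Λ r)]
    {S : ∀ r, Λ r → Type*} [∀ r l, Fintype (S r l)]
    (T : DiagramTower R 𝔽 B Λ S) (s r : ℕ) (hsr : s < r) (ν : Λ r)
    (t : T.toCellularTower.Std r ν) (x : B) (hx : x ∈ T.A r)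
    (hcomm : ∀ y ∈ T.A s, x * y = y * x) :
    ∃ c : T.toCellularTower.Std r ν → R,
      T.uStar t.1 * x -
        ∑ w : T.toCellularTower.Std r ν with t.1.trunc s hsr.le ≤ w.1.trunc s hsr.le,
          c w • T.uStar w.1 ∈ T.toCellularTower.ideal r ν := by
  obtain ⟨c, hc⟩ := T.exists_act_eq_sum r ν
    ((T.cell r).act ν (T.dPath r t.1 * ⟨x, hx⟩) (T.δ r ν))
  have hzero : ∀ w : T.toCellularTower.Std r ν,
      ¬ t.1.trunc s hsr.le ≤ w.1.trunc s hsr.le → c w = 0 := by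
    by_contra! hne
    obtain ⟨w₀, hw₀⟩ := hne
    -- With w minimal among the bad paths of nonzero coefficient, applying F_w isolates the term of
    -- w.
    obtain ⟨w, hw, hmin⟩ := Finset.exists_minimalFor (fun w : T.toCellularTower.Std r ν => w.1)
      {w | ¬ t.1.trunc s hsr.le ≤ w.1.trunc s hsr.le ∧ c w ≠ 0} ⟨w₀, by simpa using hw₀⟩
    simp only [Finset.mem_filter, Finset.mem_univ, true_and] at hw hmin
    have h := congrArg ((T.cell r).act ν (T.pathProj r w.1)) hc
    rw [← CellDatum.act_mul, mul_assoc, T.act_dPath_mul_eq_zero t, map_sum,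
      Finset.sum_eq_single w, map_smul, ← CellDatum.act_mul] at h
    · exact smul_ne_zero hw.2 (T.act_dPath_mul_pathProj_ne_zero_of_std w) h
    · intro v _ hv
      by_cases hvw : v.1 ≤ w.1
      · by_cases hcv : c v = 0
        · rw [hcv, zero_smul, map_zero]
        -- A path below a bad one is bad by transitivity, so minimality applies to v.
        · have hle : w.1 ≤ v.1 := hmin ⟨fun h1 => hw.1 fun j hj =>
            (h1 j hj).trans (hvw j (hj.trans hsr.le)), hcv⟩ hvw
          exact absurd (Subtype.ext (le_antisymm hvw hle)) hv
      · rw [map_smul, ← CellDatum.act_mul, T.act_dPath_mul_eq_zero v, smul_zero]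
        -- Plain triangularity is the case x = 1, s = r.
        have h1 := T.uStar_mul_mul_pathProj le_rfl v.1 w.1 (x := 1) (by simp) hvw
        rwa [mul_one] at h1
    · simp
    · rw [Subalgebra.coe_mul, ← mul_assoc]
      exact T.uStar_mul_mul_pathProj hsr.le t.1 w.1 hcomm hw.1
  -- The difference equals m_ν a, where a annihilates δ by the choice of c.
  refine ⟨c, (T.m r ν : T.A r) * (T.dPath r t.1 * ⟨x, hx⟩ - ∑ w, c w • T.dPath r w.1), ?_, ?_⟩
  · refine (T.m_mul_mem_above_iff ν _).2 ?_
    simp only [map_sub, map_sum, map_smul, LinearMap.sub_apply, LinearMap.sum_apply,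
      LinearMap.smul_apply]
    rw [hc, sub_self]
  · rw [Finset.sum_filter_of_ne]
    · simp [mul_sub, Finset.mul_sum, ← mul_assoc, T.m_mul_dPath_of_std]
    · intro w _ hw
      by_contra h
      exact hw (by rw [hzero w h, zero_smul])
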